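/- Let $K$ be a field, let $f\in K[x]$ be nonzero of degree $n$, let $a\in K[x]$, and let $m\ge 1$. Let $\mathcal R_m=\mathcal R_m^{(a,f)}$ be the $K[y]$-module of polynomials $r(x,y)=r_0(y)+\cdots+r_{m-1}(y)x^{m-1}\in K[x,y]$ such that $r(x,a(x))\equiv 0 \bmod f$, identified with the submodule of $K[y]^m$ formed by the coefficient vectors $(r_0,\dots,r_{m-1})^{T}$. A matrix of relations of $\mathcal R_m$ is a nonsingular matrix in $K[y]^{m\times m}$ whose columns lie in $\mathcal R_m$; it is a basis of relations if its columns generate $\mathcal R_m$. The determinantal degree $\nu_m$ of $\mathcal R_m$ is the minimal degree of the determinant of a matrix of relations of $\mathcal R_m$. Let $M_a\in K^{n\times n}$ be the matrix of multiplication by $a$ in $K[x]/(f)$ in the basis $(1,x,\dots,x^{n-1})$. The invariant factors of $\mathcal R_m$ are the monic polynomials $d_1,\dots,d_m$ with $d_{i+1}\mid d_i$ such that, for some basis $(b_1,\dots,b_m)$ of $K[y]^m$, the vectors $d_1b_1,\dots,d_mb_m$ generate $\mathcal R_m$. The invariant factors $\sigma_1,\dots,\sigma_n$ of $yI_n-M_a$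 are the monic diagonal entries of its Smith normal form, ordered so that $\sigma_{i+1}\mid\sigma_i$. Both lists exist and are unique, and the following hold. 1. If $B$ is an upper triangular basis of relations of $\mathcal R_m$, then for every $i$ its $i$-th diagonal entry equals $d_i$ up to multiplication by a nonzero element of $K$. 2. There is $k\le\min(m,n)$ such that $d_1,\dots,d_k$ are exactly the nontrivial (that is, nonconstant) ones among the invariant factors of $\mathcal R_m$, and $d_i=\sigma_i$ for $1\le i\le k$; that is, they are the $k$ invariant factors of highest degree of $yI_n-M_a$. 3. The matrix $yI_n-M_a$ is a basis of relations of $\mathcal R_n$. 4. $\nu_m=\sum_{i=1}^m\deg d_i=\sum_{i=1}^{\min(m,n)}\deg\sigma_i$, and $\min(m,n)\le\nu_m\le n$. -/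

import Mathlib

open Polynomial

section Relations

variable {K : Type*} [Field K]

/-- The module of relations of `x`-degree less than `m`. A bivariate polynomial
`r = r_0(y) + ⋯ + r_{m-1}(y) x^{m-1}` is identified with the vector `(r_0, …, r_{m-1})` of its
coefficients in `K[y]`; it is a relation when `r(x, a(x))` vanishes modulo `f`. -/
def relationModule (a f : K[X]) (m : ℕ) : Submodule K[X] (Fin m → K[X]) where
  carrier := {r | f ∣ ∑ i : Fin m, (r i).comp a * X ^ (i : ℕ)}
  zero_mem' := by simp
  add_mem' := by
    intro r s hr hs
    have h := dvd_add hr hs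
    rw [← Finset.sum_add_distrib] at h
    simpa [add_mul] using h
  smul_mem' := by
    intro p r hr
    have h := Dvd.dvd.mul_left hr (p.comp a)
    rw [Finset.mul_sum] at h
    simpa [mul_assoc] using h

/-- A nonsingular square matrix whose columns belong to the module `N`. -/
def IsMatrixOfRelations {m : ℕ} (N : Submodule K[X] (Fin m → K[X]))
    (B : Matrix (Fin m) (Fin m) K[X]) : Prop :=
  B.det ≠ 0 ∧ ∀ j, (fun i => B i j) ∈ N

/-- A matrix of relations whose columns generate the module `N`. -/
def IsBasisOfRelations {m : ℕ} (N : Submodule K[X] (Fin m → K[X]))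
    (B : Matrix (Fin m) (Fin m) K[X]) : Prop :=
  IsMatrixOfRelations N B ∧ Submodule.span K[X] (Set.range fun j i => B i j) = N

/-- The determinantal degree: the least degree of the determinant of a matrix of relations. -/
noncomputable def determinantalDegree {m : ℕ} (N : Submodule K[X] (Fin m → K[X])) : ℕ :=
  sInf {e | ∃ B : Matrix (Fin m) (Fin m) K[X], IsMatrixOfRelations N B ∧ B.det.natDegree = e}

/-- Normalization of a family of invariant factors: each one is monic (or zero), and they are
listed from the largest to the smallest for divisibility. -/
def IsNormalizedChain {m : ℕ} (d : Fin m → K[X]) : Prop :=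
  (∀ i, d i = 0 ∨ (d i).Monic) ∧ ∀ i j, i ≤ j → d j ∣ d i

/-- `d` lists the invariant factors of the submodule `N` of `K[y]^m`: for some basis `b` of
`K[y]^m`, the module `N` is generated by the multiples `d i • b i`. -/
def IsInvariantFactorsOfModule {m : ℕ} (N : Submodule K[X] (Fin m → K[X]))
    (d : Fin m → K[X]) : Prop :=
  IsNormalizedChain d ∧ ∃ b : Module.Basis (Fin m) K[X] (Fin m → K[X]),
    N = Submodule.span K[X] (Set.range fun i => d i • b i)

/-- `d` lists the invariant factors of the square matrix `A`: the diagonal matrix of `d` is a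
Smith normal form of `A`. -/
def IsInvariantFactorsOfMatrix {n : ℕ} (A : Matrix (Fin n) (Fin n) K[X])
    (d : Fin n → K[X]) : Prop :=
  IsNormalizedChain d ∧ ∃ U V : (Matrix (Fin n) (Fin n) K[X])ˣ,
    U.val * A * V.val = Matrix.diagonal d

/-- The matrix of multiplication by `a` in `K[x]/(f)`, in the basis `1, x, …, x^(n-1)` where
`n = deg f`. -/
noncomputable def mulMatrix (a f : K[X]) (hf : f ≠ 0) :
    Matrix (Fin f.natDegree) (Fin f.natDegree) K :=
  Algebra.leftMulMatrix (AdjoinRoot.powerBasisAux hf) (AdjoinRoot.mk f a)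

end Relations

/-! ### Leading coefficient ideals in `R[X]` (Lazard's structure theorem) -/

section Lazard

variable {R : Type*} [CommRing R]

/-! All relations, of any `x`-degree, form one ideal `I` of `K[y][x]`. Let `h_j` be the monic
generator of the ideal of `x^j`-coefficients of elements of `I` of `x`-degree at most `j`. It is
nonzero because `I` meets `K[y]` nontrivially (Cayley-Hamilton), and `h_{j+1} ∣ h_j`.

Lazard's argument shows that `h_j` divides every element of `I` of degree at most `j`, so `I`
contains some `h_j g_j` with `g_j` monic of degree `j` in `x`. Those with `j < m` generate the
relations of degree less than `m`, and the coefficient matrix of the `g_j` is unit upper triangular.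
Hence `h_0, …, h_{m-1}` are the invariant factors of the module for every `m`: growing `m` only
lengthens the list.

For `m = n` the columns of the characteristic matrix generate the module, since modulo them every
vector is constant and no nonzero constant vector is a relation. So `σ` is `h_0, …, h_{n-1}`, and
the degrees add up to that of the characteristic polynomial, `n`. Beyond that `h_j = 1`, because
`f(x)` is itself a relation. -/

theorem mem_leadingCoeffNth_iff_coeff {I : Ideal R[X]} {n : ℕ} {x : R} :
    x ∈ I.leadingCoeffNth n ↔ ∃ p ∈ I, p.natDegree ≤ n ∧ p.coeff n = x := by
  simp only [Ideal.leadingCoeffNth, Ideal.degreeLE, Submodule.mem_map, Submodule.mem_inf,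
    mem_degreeLE, lcoeff_apply, natDegree_le_iff_degree_le]
  constructor
  · rintro ⟨p, ⟨h1, h2⟩, h3⟩
    exact ⟨p, h2, h1, h3⟩
  · rintro ⟨p, h2, h1, h3⟩
    exact ⟨p, ⟨h1, h2⟩, h3⟩

/-- If `h j` generates the ideal of `j`-th leading coefficients of `I`, then `h j` divides every
element of `I` of degree at most `j`. -/
theorem C_dvd_of_leadingCoeffNth [IsDomain R] {I : Ideal R[X]} {h : ℕ → R} (h0 : ∀ j, h j ≠ 0)
    (hh : ∀ j, I.leadingCoeffNth j = Ideal.span {h j}) (j : ℕ) :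
    ∀ p ∈ I, p.natDegree ≤ j → C (h j) ∣ p := by
  have hcoeff : ∀ j, ∀ p ∈ I, p.natDegree ≤ j → h j ∣ p.coeff j := fun j p hp hd => by
    rw [← Ideal.mem_span_singleton, ← hh]
    exact mem_leadingCoeffNth_iff_coeff.2 ⟨p, hp, hd, rfl⟩
  induction j with
  | zero =>
    intro p hp hd
    obtain ⟨c, hc⟩ := hcoeff 0 p hp hd
    rw [eq_C_of_natDegree_le_zero hd, hc, C_mul]
    exact dvd_mul_right _ _
  | succ j ih =>
    have hex : ∀ j, ∃ p ∈ I, p.natDegree ≤ j ∧ p.coeff j = h j := fun j =>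
      mem_leadingCoeffNth_iff_coeff.1 (hh j ▸ Ideal.mem_span_singleton_self _)
    obtain ⟨q, hq, hqd, hqc⟩ := hex j
    obtain ⟨g, hg, hgd, hgc⟩ := hex (j + 1)
    -- A vanishing top coefficient lowers the degree to at most `j`, where the induction hypothesis
    -- applies.
    have hlower : ∀ p ∈ I, p.natDegree ≤ j + 1 → p.coeff (j + 1) = 0 → C (h j) ∣ p := by
      intro p hp hd hc
      refine ih p hp ?_
      rw [natDegree_le_iff_coeff_eq_zero]
      intro k hk
      rcases (Nat.succ_le_of_lt hk).eq_or_lt with rfl | hk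
      · exact hc
      · exact coeff_eq_zero_of_natDegree_lt (hd.trans_lt hk)
    obtain ⟨e, he⟩ : h (j + 1) ∣ h j := by
      have := hcoeff (j + 1) (X * q) (I.mul_mem_left _ hq)
        ((natDegree_mul_le).trans (by have := natDegree_X_le (R := R); omega))
      rwa [coeff_X_mul, hqc] at this
    have he0 : e ≠ 0 := by
      rintro rfl
      exact h0 j (by simp [he])
    -- The top coefficients of `e g` and `X q` are both `h j`, so their difference is divisible by
    -- `h j`, and then so is `e g`. Since `h j = h (j + 1) * e`, cancelling `e` gives the claim.
    have hg' : C (h (j + 1)) ∣ g := by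
      have h1 : C (h j) ∣ C e * g - X * q := by
        refine hlower _ (I.sub_mem (I.mul_mem_left _ hg) (I.mul_mem_left _ hq)) ?_ ?_
        · refine (natDegree_sub_le _ _).trans (max_le ((natDegree_C_mul_le _ _).trans hgd) ?_)
          exact (natDegree_mul_le).trans (by have := natDegree_X_le (R := R); omega)
        · rw [coeff_sub, coeff_C_mul, hgc, coeff_X_mul, hqc, he]
          ring
      have h2 : C (h j) ∣ C e * g := by
        have := dvd_add h1 (Dvd.dvd.mul_left (ih q hq hqd) X)
        rwa [sub_add_cancel] at this
      rw [he, mul_comm, C_mul] at h2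
      exact (mul_dvd_mul_iff_left (C_ne_zero.2 he0)).1 h2
    intro p hp hd
    obtain ⟨c, hc⟩ := hcoeff (j + 1) p hp hd
    have h1 : C (h j) ∣ p - C c * g := by
      refine hlower _ (I.sub_mem hp (I.mul_mem_left _ hg)) ?_ ?_
      · exact (natDegree_sub_le _ _).trans (max_le hd ((natDegree_C_mul_le _ _).trans hgd))
      · rw [coeff_sub, coeff_C_mul, hgc, hc]
        ring
    have h2 := dvd_add ((map_dvd C (Dvd.intro _ he.symm)).trans h1) (hg'.mul_left (C c))
    rwa [sub_add_cancel] at h2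

/-- Lazard's structure theorem for ideals of `R[X]` whose leading coefficient ideals are principal
and nonzero: up to multiplication by a scalar, a generator in each degree is monic. -/
theorem exists_monic_of_leadingCoeffNth [IsDomain R] {I : Ideal R[X]} {h : ℕ → R}
    (h0 : ∀ j, h j ≠ 0) (hh : ∀ j, I.leadingCoeffNth j = Ideal.span {h j}) (j : ℕ) :
    ∃ g : R[X], C (h j) * g ∈ I ∧ g.natDegree ≤ j ∧ g.coeff j = 1 := by
  obtain ⟨p, hp, hd, hc⟩ : ∃ p ∈ I, p.natDegree ≤ j ∧ p.coeff j = h j :=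
    mem_leadingCoeffNth_iff_coeff.1 (hh j ▸ Ideal.mem_span_singleton_self _)
  obtain ⟨g, rfl⟩ := C_dvd_of_leadingCoeffNth h0 hh j p hp hd
  rw [natDegree_C_mul (h0 j)] at hd
  rw [coeff_C_mul] at hc
  exact ⟨g, hp, hd, mul_left_cancel₀ (h0 j) (hc.trans (mul_one _).symm)⟩

/-- Elements of degree less than `m` are combinations of the distinguished generators. -/
theorem exists_eq_sum_of_leadingCoeffNth [IsDomain R] {I : Ideal R[X]} {h : ℕ → R}
    (hh : ∀ j, I.leadingCoeffNth j = Ideal.span {h j}) {g : ℕ → R[X]}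
    (hI : ∀ j, C (h j) * g j ∈ I) (hgd : ∀ j, (g j).natDegree ≤ j) (hgc : ∀ j, (g j).coeff j = 1)
    (m : ℕ) : ∀ p ∈ I, p.degree < m →
      ∃ c : ℕ → R, p = ∑ j ∈ Finset.range m, C (c j) * (C (h j) * g j) := by
  induction m with
  | zero =>
    intro p _ hd
    refine ⟨0, ?_⟩
    simpa using hd
  | succ m ih =>
    intro p hp hd
    have hd' : p.natDegree ≤ m := by
      rw [natDegree_le_iff_degree_le]
      exact Order.le_of_lt_succ hd
    obtain ⟨c, hc⟩ : h m ∣ p.coeff m := by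
      rw [← Ideal.mem_span_singleton, ← hh]
      exact mem_leadingCoeffNth_iff_coeff.2 ⟨p, hp, hd', rfl⟩
    obtain ⟨b, hb⟩ := ih (p - C c * (C (h m) * g m))
      (I.sub_mem hp (I.mul_mem_left _ (hI m))) (by
        rw [degree_lt_iff_coeff_zero]
        intro k hk
        rcases hk.eq_or_lt with rfl | hk
        · simp [coeff_C_mul, hgc, hc, mul_comm]
        · simp [coeff_C_mul, coeff_eq_zero_of_natDegree_lt (hd'.trans_lt hk),
            coeff_eq_zero_of_natDegree_lt ((hgd m).trans_lt hk)])
    refine ⟨Function.update b m c, ?_⟩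
    rw [Finset.sum_range_succ, Function.update_self, ← sub_eq_iff_eq_add, hb]
    refine Finset.sum_congr rfl fun j hj => ?_
    rw [Function.update_of_ne (Finset.mem_range.1 hj).ne]

end Lazard

/-! ### Column modules and divisibility of diagonal forms -/

section Matrices

variable {R : Type*} [CommRing R] {m : ℕ}

theorem Matrix.span_cols_eq_range (B : Matrix (Fin m) (Fin m) R) :
    Submodule.span R (Set.range fun j i => B i j) = LinearMap.range B.mulVecLin :=
  (Matrix.range_mulVecLin B).symm

theorem Matrix.range_le_range_iff {A B : Matrix (Fin m) (Fin m) R} :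
    LinearMap.range A.mulVecLin ≤ LinearMap.range B.mulVecLin ↔ ∃ W, A = B * W := by
  constructor
  · intro h
    have : ∀ j, ∃ w, B.mulVec w = A.col j := fun j => by
      have : A.col j ∈ LinearMap.range B.mulVecLin := h ⟨Pi.single j 1, by simp⟩
      exact this
    choose w hw using this
    refine ⟨Matrix.of fun i j => w j i, ?_⟩
    ext i j
    exact (congrFun (hw j) i).symm
  · rintro ⟨W, rfl⟩
    rw [Matrix.mulVecLin_mul]
    exact LinearMap.range_comp_le_range _ _

/-- Nonsingular matrices with the same column module differ by a unimodular factor. -/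
theorem Matrix.exists_unit_of_range_eq [IsDomain R] {A B : Matrix (Fin m) (Fin m) R}
    (hA : A.det ≠ 0) (h : LinearMap.range A.mulVecLin = LinearMap.range B.mulVecLin) :
    ∃ W : (Matrix (Fin m) (Fin m) R)ˣ, A = B * W.val := by
  obtain ⟨W, hW⟩ := Matrix.range_le_range_iff.1 h.le
  obtain ⟨V, hV⟩ := Matrix.range_le_range_iff.1 h.ge
  have h1 : IsUnit W.det := by
    refine IsUnit.of_mul_eq_one V.det (mul_left_cancel₀ hA ?_)
    nth_rw 2 [hW]
    rw [hV, Matrix.det_mul, Matrix.det_mul]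
    ring
  obtain ⟨U, rfl⟩ := (Matrix.isUnit_iff_isUnit_det W).2 h1
  exact ⟨U, hW⟩

/-- Every permutation sends some index `k ≥ i` to an index at most `i`. -/
theorem exists_le_perm_le (i : Fin m) (s : Equiv.Perm (Fin m)) : ∃ k, i ≤ k ∧ s k ≤ i := by
  by_contra! hcon
  have h1 : ((Finset.Ici i).map s.toEmbedding) ⊆ Finset.Ioi i := by
    intro x hx
    obtain ⟨k, hk, rfl⟩ := Finset.mem_map.1 hx
    exact Finset.mem_Ioi.2 (hcon k (Finset.mem_Ici.1 hk))
  have h2 := Finset.card_le_card h1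
  rw [Finset.card_map, Fin.card_Ici, Fin.card_Ioi] at h2
  omega

/-- Divisibility of invariant factors under inclusion of column modules. -/
theorem dvd_of_diagonal_mul_eq {d d' : Fin m → R} (hd : ∀ i j, i ≤ j → d j ∣ d i)
    (hd' : ∀ i j, i ≤ j → d' j ∣ d' i) {P W : Matrix (Fin m) (Fin m) R} (hP : IsUnit P)
    (h : P * Matrix.diagonal d = Matrix.diagonal d' * W) (i : Fin m) : d' i ∣ d i := by
  -- Entries of `P` in rows up to `i` and columns from `i` on become multiples of `d' i` once scaled
  -- by `d i`. Every Leibniz term of `P.det` contains such an entry, and `P.det` is a unit.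
  have key : ∀ j k, j ≤ i → i ≤ k → d' i ∣ d i * P j k := by
    intro j k hj hk
    have h1 := congrFun (congrFun h j) k
    rw [Matrix.mul_diagonal, Matrix.diagonal_mul] at h1
    have h2 : d' j ∣ P j k * d k := ⟨_, h1⟩
    exact (hd' j i hj).trans (h2.trans (mul_comm (d i) _ ▸ mul_dvd_mul_left _ (hd i k hk)))
  have hdet : d' i ∣ d i * P.det := by
    rw [Matrix.det_apply, Finset.mul_sum]
    refine Finset.dvd_sum fun s _ => ?_
    obtain ⟨k, hk, hs⟩ := exists_le_perm_le i s
    rw [mul_smul_comm]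
    refine Dvd.dvd.trans ?_ (Dvd.intro_left ((Equiv.Perm.sign s : ℤ) : R)
      (by rw [Units.smul_def, zsmul_eq_mul]))
    exact (key _ k hs hk).trans (mul_dvd_mul_left _ (Finset.dvd_prod_of_mem _ (Finset.mem_univ k)))
  exact ((Matrix.isUnit_iff_isUnit_det P).1 hP).dvd_mul_right.1 hdet

end Matrices

/-! ### The ideal of relations and its leading coefficients -/

section RelationIdeal

variable {K : Type*} [Field K]

/-- The ideal of bivariate relations; the outer variable is `x`, the coefficients are in `K[y]`. -/
noncomputable def relationIdeal (a f : K[X]) : Ideal K[X][X] :=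
  (Ideal.span {f}).comap (eval₂RingHom (compRingHom a) X)

theorem mem_relationIdeal {a f : K[X]} {p : K[X][X]} :
    p ∈ relationIdeal a f ↔ f ∣ eval₂ (compRingHom a) X p := by
  rw [relationIdeal, Ideal.mem_comap, Ideal.mem_span_singleton, coe_eval₂RingHom]

theorem mem_relationModule_iff {a f : K[X]} {m : ℕ} {r : Fin m → K[X]} :
    r ∈ relationModule a f m ↔ ∑ i : Fin m, C (r i) * X ^ (i : ℕ) ∈ relationIdeal a f := by
  rw [mem_relationIdeal, eval₂_finsetSum]
  simp only [eval₂_mul, eval₂_C, eval₂_pow, eval₂_X, coe_compRingHom_apply]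
  exact Iff.rfl

theorem coeff_mem_relationModule_iff {a f : K[X]} {m : ℕ} {p : K[X][X]} (hp : p.degree < m) :
    (fun i : Fin m => p.coeff i) ∈ relationModule a f m ↔ p ∈ relationIdeal a f := by
  rw [mem_relationModule_iff, sum_fin (fun i c => C c * X ^ i) (by simp) hp,
    sum_C_mul_X_pow_eq]

/-- By Cayley-Hamilton, the characteristic polynomial of multiplication by `a` vanishes at the class
of `a` modulo `f`. -/
theorem exists_C_mem_relationIdeal (a : K[X]) {f : K[X]} (hf : f ≠ 0) :
    ∃ c : K[X], c ≠ 0 ∧ C c ∈ relationIdeal a f := by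
  refine ⟨(mulMatrix a f hf).charpoly, (Matrix.charpoly_monic _).ne_zero, ?_⟩
  rw [mem_relationIdeal, eval₂_C, coe_compRingHom_apply, ← AdjoinRoot.mk_eq_zero]
  have h1 : aeval (mulMatrix a f hf) (mulMatrix a f hf).charpoly = 0 :=
    Matrix.aeval_self_charpoly _
  generalize (mulMatrix a f hf).charpoly = p at h1
  rw [mulMatrix, aeval_algHom_apply] at h1
  have h2 := Algebra.leftMulMatrix_injective (AdjoinRoot.powerBasisAux hf)
    (h1.trans (map_zero _).symm)
  rw [← h2, comp_eq_aeval]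
  exact (aeval_algHom_apply (AdjoinRoot.mkₐ f) a p).symm

theorem leadingCoeffNth_relationIdeal_ne_bot (a : K[X]) {f : K[X]} (hf : f ≠ 0) (j : ℕ) :
    (relationIdeal a f).leadingCoeffNth j ≠ ⊥ := by
  obtain ⟨c, hc, h⟩ := exists_C_mem_relationIdeal a hf
  refine fun hbot => hc ?_
  rw [← Ideal.mem_bot, ← hbot]
  exact Ideal.leadingCoeffNth_mono _ (Nat.zero_le j) ((Ideal.mem_leadingCoeffNth_zero _ _).2 h)

/-- The monic generator of the ideal of `x^j`-coefficients of relations of `x`-degree at most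
`j`. -/
noncomputable def relationFactor (a f : K[X]) (j : ℕ) : K[X] :=
  Submodule.IsPrincipal.generator ((relationIdeal a f).leadingCoeffNth j) *
    C (Submodule.IsPrincipal.generator ((relationIdeal a f).leadingCoeffNth j)).leadingCoeff⁻¹

theorem generator_leadingCoeffNth_ne_zero (a : K[X]) {f : K[X]} (hf : f ≠ 0) (j : ℕ) :
    Submodule.IsPrincipal.generator ((relationIdeal a f).leadingCoeffNth j) ≠ 0 := by
  rw [Ne, ← Submodule.IsPrincipal.eq_bot_iff_generator_eq_zero]
  exact leadingCoeffNth_relationIdeal_ne_bot a hf j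

theorem leadingCoeffNth_relationIdeal (a : K[X]) {f : K[X]} (hf : f ≠ 0) (j : ℕ) :
    (relationIdeal a f).leadingCoeffNth j = Ideal.span {relationFactor a f j} := by
  have h := generator_leadingCoeffNth_ne_zero a hf j
  rw [relationFactor, Ideal.span_singleton_mul_right_unit, Ideal.span_singleton_generator]
  exact isUnit_C.2 (inv_ne_zero (leadingCoeff_ne_zero.2 h)).isUnit

theorem relationFactor_monic (a : K[X]) {f : K[X]} (hf : f ≠ 0) (j : ℕ) :
    (relationFactor a f j).Monic :=
  monic_mul_leadingCoeff_inv (generator_leadingCoeffNth_ne_zero a hf j)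

theorem relationFactor_dvd (a : K[X]) {f : K[X]} (hf : f ≠ 0) {i j : ℕ} (h : i ≤ j) :
    relationFactor a f j ∣ relationFactor a f i := by
  rw [← Ideal.span_singleton_le_span_singleton, ← leadingCoeffNth_relationIdeal a hf,
    ← leadingCoeffNth_relationIdeal a hf]
  exact Ideal.leadingCoeffNth_mono _ h

theorem relationFactor_eq_one (a : K[X]) {f : K[X]} (hf : f ≠ 0) {j : ℕ} (hj : f.natDegree ≤ j) :
    relationFactor a f j = 1 := by
  refine (relationFactor_monic a hf j).eq_one_of_isUnit (isUnit_of_dvd_unit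
    (relationFactor_dvd a hf hj) ?_)
  rw [← Ideal.span_singleton_eq_top, ← leadingCoeffNth_relationIdeal a hf, Ideal.eq_top_iff_one]
  -- The witness is `f` made monic, read as a polynomial in `x` with coefficients constant in `y`.
  refine mem_leadingCoeffNth_iff_coeff.2 ⟨(f * C f.leadingCoeff⁻¹).map C, ?_, ?_, ?_⟩
  · rw [mem_relationIdeal, eval₂_map]
    have : (compRingHom a).comp C = (C : K →+* K[X]) := by ext x; simp
    rw [this, eval₂_C_X]
    exact dvd_mul_right _ _
  · exact natDegree_map_le.trans (natDegree_mul_C_le _ _)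
  · rw [coeff_map, coeff_mul_C, coeff_natDegree, mul_inv_cancel₀ (leadingCoeff_ne_zero.2 hf), C_1]

/-- When the later entries vanish, `r i` is the `x^i`-coefficient of a relation of `x`-degree at
most `i`. -/
theorem relationFactor_dvd_apply (a : K[X]) {f : K[X]} (hf : f ≠ 0) {m : ℕ} {r : Fin m → K[X]}
    (hr : r ∈ relationModule a f m) {i : Fin m} (h : ∀ j, i < j → r j = 0) :
    relationFactor a f i ∣ r i := by
  rw [← Ideal.mem_span_singleton, ← leadingCoeffNth_relationIdeal a hf]
  refine mem_leadingCoeffNth_iff_coeff.2 ⟨_, mem_relationModule_iff.1 hr, ?_, ?_⟩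
  · refine natDegree_sum_le_of_forall_le _ _ fun j _ => ?_
    rcases le_or_gt j i with hj | hj
    · exact (natDegree_C_mul_X_pow_le _ _).trans hj
    · simp [h j hj]
  · simp [finsetSum_coeff, coeff_X_pow, Fin.val_inj]

/-- The relations of `x`-degree less than `m` are the column module of the product of a unimodular
matrix and the diagonal matrix of the relation factors. -/
theorem exists_relationModule_eq_range (a : K[X]) {f : K[X]} (hf : f ≠ 0) (m : ℕ) :
    ∃ P : (Matrix (Fin m) (Fin m) K[X])ˣ, relationModule a f m = LinearMap.range
      (P.val * Matrix.diagonal fun i : Fin m => relationFactor a f i).mulVecLin := by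
  have h0 : ∀ j, relationFactor a f j ≠ 0 := fun j => (relationFactor_monic a hf j).ne_zero
  have hh := leadingCoeffNth_relationIdeal a hf
  choose g hI hgd hgc using exists_monic_of_leadingCoeffNth h0 hh
  -- Column `j` lists the coefficients of `g j`, so `G` is upper triangular with ones on the
  -- diagonal.
  let G : Matrix (Fin m) (Fin m) K[X] := Matrix.of fun i j => (g j).coeff i
  have hG : IsUnit G := by
    rw [Matrix.isUnit_iff_isUnit_det, Matrix.det_of_isUpperTriangular]
    · simp [G, hgc]
    · intro i j hij
      exact coeff_eq_zero_of_natDegree_lt ((hgd j).trans_lt hij)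
  have hcol : ∀ j : Fin m, (G * Matrix.diagonal fun i : Fin m => relationFactor a f i).col j
      = fun i : Fin m => (C (relationFactor a f j) * g j).coeff i := by
    intro j
    ext1 i
    rw [Matrix.col_apply, Matrix.mul_diagonal, coeff_C_mul, mul_comm]
    rfl
  refine ⟨hG.unit, ?_⟩
  rw [IsUnit.unit_spec, Matrix.range_mulVecLin]
  apply le_antisymm
  · intro r hr
    obtain ⟨c, hc⟩ := exists_eq_sum_of_leadingCoeffNth hh hI hgd hgc m _
      (mem_relationModule_iff.1 hr) (degree_sum_fin_lt r)
    have hr' : r = ∑ j : Fin m, c j •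
        (G * Matrix.diagonal fun i : Fin m => relationFactor a f i).col j := by
      ext1 i
      have := congrArg (fun p => p.coeff (i : ℕ)) hc
      rw [← Fin.sum_univ_eq_sum_range (fun j => C (c j) * (C (relationFactor a f j) * g j))] at this
      simp only [finsetSum_coeff, coeff_C_mul, coeff_X_pow, Fin.val_inj, mul_ite, mul_one,
        mul_zero, Finset.sum_ite_eq, Finset.mem_univ, if_true] at this
      rw [this]
      simp only [hcol, Finset.sum_apply, Pi.smul_apply, smul_eq_mul, coeff_C_mul]
    rw [hr']
    exact Submodule.sum_mem _ fun j _ => Submodule.smul_mem _ _ (Submodule.subset_span ⟨j, rfl⟩)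
  · rw [Submodule.span_le]
    rintro _ ⟨j, rfl⟩
    rw [hcol]
    refine (coeff_mem_relationModule_iff ?_).2 (hI j)
    rw [degree_C_mul (h0 j)]
    exact degree_le_natDegree.trans_lt (by exact_mod_cast (hgd j).trans_lt j.isLt)

end RelationIdeal

/-! ### The characteristic matrix as a basis of relations -/

section CharacteristicMatrix

variable {K : Type*} [Field K]

theorem powerBasisAux_apply {f : K[X]} (hf : f ≠ 0) (i : Fin f.natDegree) :
    AdjoinRoot.powerBasisAux hf i = AdjoinRoot.root f ^ (i : ℕ) :=
  (AdjoinRoot.powerBasis hf).basis_eq_pow i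

/-- A vector of constants is a relation only if it vanishes. -/
theorem eq_zero_of_C_mem_relationModule {a f : K[X]} (hf : f ≠ 0) {w : Fin f.natDegree → K}
    (h : (fun i => C (w i)) ∈ relationModule a f f.natDegree) : w = 0 := by
  have h1 : f ∣ ∑ i : Fin f.natDegree, C (w i) * X ^ (i : ℕ) := by
    have h2 : f ∣ ∑ i : Fin f.natDegree, (C (w i)).comp a * X ^ (i : ℕ) := h
    simpa using h2
  have h2 := eq_zero_of_dvd_of_degree_lt h1
    ((degree_sum_fin_lt w).trans_eq (degree_eq_natDegree hf).symm)
  ext i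
  have := congrArg (fun p => p.coeff (i : ℕ)) h2
  simpa [finsetSum_coeff, coeff_X_pow, Fin.val_inj] using this

/-- Column `j` encodes `y x^j` minus the reduction of `a x^j` modulo `f`; substituting `y = a(x)`
gives zero modulo `f`. -/
theorem charmatrix_col_mem_relationModule (a : K[X]) {f : K[X]} (hf : f ≠ 0)
    (j : Fin f.natDegree) :
    (mulMatrix a f hf).charmatrix.col j ∈ relationModule a f f.natDegree := by
  change f ∣ ∑ i : Fin f.natDegree,
    ((mulMatrix a f hf).charmatrix i j).comp a * X ^ (i : ℕ)
  simp only [Matrix.charmatrix_apply, sub_comp, sub_mul, Finset.sum_sub_distrib, C_comp,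
    Matrix.diagonal_apply, apply_ite (fun p : K[X] => p.comp a), X_comp, zero_comp, ite_mul,
    zero_mul, Finset.sum_ite_eq', Finset.mem_univ, if_true]
  rw [← AdjoinRoot.mk_eq_zero, map_sub, map_mul, map_pow, AdjoinRoot.mk_X, map_sum, sub_eq_zero,
    ← powerBasisAux_apply hf j, ← (AdjoinRoot.powerBasisAux hf).sum_repr
      (AdjoinRoot.mk f a * AdjoinRoot.powerBasisAux hf j)]
  refine Finset.sum_congr rfl fun i _ => ?_
  rw [mulMatrix, Algebra.leftMulMatrix_eq_repr_mul, (AdjoinRoot.mk f).map_mul,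
    (AdjoinRoot.mk f).map_pow, AdjoinRoot.mk_X, AdjoinRoot.mk_C, powerBasisAux_apply hf i, Algebra.smul_def]
  rfl

/-- Modulo the columns of a characteristic matrix, every vector is congruent to a constant one. -/
theorem exists_sub_C_mem_range_charmatrix {n : ℕ} (M : Matrix (Fin n) (Fin n) K)
    (v : Fin n → K[X]) :
    ∃ w : Fin n → K, v - (fun i => C (w i)) ∈ LinearMap.range M.charmatrix.mulVecLin := by
  have hadd : ∀ u v : Fin n → K[X],
      (∃ w : Fin n → K, u - (fun i => C (w i)) ∈ LinearMap.range M.charmatrix.mulVecLin) →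
      (∃ w : Fin n → K, v - (fun i => C (w i)) ∈ LinearMap.range M.charmatrix.mulVecLin) →
      ∃ w : Fin n → K, u + v - (fun i => C (w i)) ∈ LinearMap.range M.charmatrix.mulVecLin := by
    rintro u v ⟨w, hw⟩ ⟨z, hz⟩
    refine ⟨w + z, ?_⟩
    convert add_mem hw hz using 1
    ext1 i
    simp only [Pi.sub_apply, Pi.add_apply, C_add]
    ring
  -- Modulo the columns, multiplication by `y` acts on constant vectors as `M`, which lowers powers
  -- of `y` one at a time.
  have hmul : ∀ w : Fin n → K, (X : K[X]) • (fun i => C (w i)) - (fun i => C (M.mulVec w i)) =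
      M.charmatrix.mulVec (fun i => C (w i)) := by
    intro w
    ext1 i
    simp only [Matrix.charmatrix, Matrix.sub_mulVec, Pi.sub_apply, Pi.smul_apply, smul_eq_mul,
      Matrix.scalar_apply, Matrix.mulVec_diagonal]
    congr 1
    simp [Matrix.mulVec, dotProduct]
  have hsingle : ∀ (j : Fin n) (p : K[X]), ∃ w : Fin n → K,
      Pi.single j p - (fun i => C (w i)) ∈ LinearMap.range M.charmatrix.mulVecLin := by
    intro j p
    induction p using Polynomial.induction_on with
    | C c =>
      refine ⟨Pi.single j c, ?_⟩
      convert Submodule.zero_mem (LinearMap.range M.charmatrix.mulVecLin) using 1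
      ext1 i
      rcases eq_or_ne i j with rfl | h
      · simp
      · simp [h]
    | add p q hp hq =>
      rw [Pi.single_add]
      exact hadd _ _ hp hq
    | monomial k c ih =>
      obtain ⟨w, hw⟩ := ih
      refine ⟨M.mulVec w, ?_⟩
      have h1 := add_mem (Submodule.smul_mem _ (X : K[X]) hw)
        (LinearMap.mem_range_self M.charmatrix.mulVecLin (fun i => C (w i)))
      rw [Matrix.mulVecLin_apply, ← hmul, smul_sub, sub_add_sub_cancel, ← Pi.single_smul',
        smul_eq_mul] at h1
      rwa [pow_succ, ← mul_assoc, mul_comm _ X]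
  rw [← Finset.univ_sum_single v]
  refine Finset.sum_induction _ (fun u => ∃ w : Fin n → K,
    u - (fun i => C (w i)) ∈ LinearMap.range M.charmatrix.mulVecLin) hadd ⟨0, ?_⟩
    fun j _ => hsingle j (v j)
  convert Submodule.zero_mem (LinearMap.range M.charmatrix.mulVecLin) using 1
  ext1 i
  simp

/-- A relation is congruent, modulo columns that are themselves relations, to a constant relation,
which must be zero. -/
theorem relationModule_eq_range_charmatrix (a : K[X]) {f : K[X]} (hf : f ≠ 0) :
    relationModule a f f.natDegree =
      LinearMap.range (mulMatrix a f hf).charmatrix.mulVecLin := by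
  have hle : LinearMap.range (mulMatrix a f hf).charmatrix.mulVecLin ≤
      relationModule a f f.natDegree := by
    rw [Matrix.range_mulVecLin, Submodule.span_le]
    rintro _ ⟨j, rfl⟩
    exact charmatrix_col_mem_relationModule a hf j
  refine le_antisymm (fun v hv => ?_) hle
  obtain ⟨w, hw⟩ := exists_sub_C_mem_range_charmatrix (mulMatrix a f hf) v
  have h1 := sub_mem hv (hle hw)
  rw [sub_sub_cancel] at h1
  rw [eq_zero_of_C_mem_relationModule hf h1] at hw
  convert hw using 1
  ext1 i
  simp

end CharacteristicMatrix

/-! ### Invariant factors: matrix form, uniqueness, determinantal degree -/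

section InvariantFactors

variable {K : Type*} [Field K] {m : ℕ}

theorem isInvariantFactorsOfModule_iff {N : Submodule K[X] (Fin m → K[X])} {d : Fin m → K[X]} :
    IsInvariantFactorsOfModule N d ↔ IsNormalizedChain d ∧
      ∃ P : (Matrix (Fin m) (Fin m) K[X])ˣ,
        N = LinearMap.range (P.val * Matrix.diagonal d).mulVecLin := by
  refine and_congr_right fun _ => ?_
  have hcol : ∀ P : Matrix (Fin m) (Fin m) K[X],
      LinearMap.range (P * Matrix.diagonal d).mulVecLin =
        Submodule.span K[X] (Set.range fun j => d j • P.col j) := by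
    intro P
    rw [Matrix.range_mulVecLin]
    congr 2
    ext j i
    simp [mul_comm]
  constructor
  · rintro ⟨b, hb⟩
    refine ⟨(Matrix.isUnit_iff_isUnit_det ((Pi.basisFun K[X] (Fin m)).toMatrix b)).2
      (by rw [← Module.Basis.det_apply]; exact Module.Basis.isUnit_det _ b) |>.unit, ?_⟩
    rw [hcol, hb]
    rfl
  · rintro ⟨P, hP⟩
    refine ⟨(Pi.basisFun K[X] (Fin m)).map (Matrix.toLinearEquiv' P.val P.invertible), ?_⟩
    rw [hP, hcol]
    congr 2
    ext1 j
    rw [Module.Basis.map_apply, Pi.basisFun_apply]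
    congr 1
    have := LinearMap.congr_fun (Matrix.toLinearEquiv'_apply P.val P.invertible) (Pi.single j 1)
    refine Eq.trans ?_ this.symm
    simp

theorem IsNormalizedChain.eq_of_dvd {d d' : Fin m → K[X]} (hd : IsNormalizedChain d)
    (hd' : IsNormalizedChain d') (h : ∀ i, d i ∣ d' i) (h' : ∀ i, d' i ∣ d i) : d = d' := by
  ext1 i
  rcases hd.1 i with h0 | h1
  · rw [h0, zero_dvd_iff.1 (h0 ▸ h i : 0 ∣ d' i)]
  rcases hd'.1 i with h0 | h1'
  · rw [h0, zero_dvd_iff.1 (h0 ▸ h' i : 0 ∣ d i)]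
  exact eq_of_monic_of_associated h1 h1' (associated_of_dvd_dvd (h i) (h' i))

theorem dvd_of_range_le {d d' : Fin m → K[X]} (hd : IsNormalizedChain d)
    (hd' : IsNormalizedChain d') {P P' : (Matrix (Fin m) (Fin m) K[X])ˣ}
    (h : LinearMap.range (P.val * Matrix.diagonal d).mulVecLin ≤
      LinearMap.range (P'.val * Matrix.diagonal d').mulVecLin) (i : Fin m) : d' i ∣ d i := by
  obtain ⟨W, hW⟩ := Matrix.range_le_range_iff.1 h
  refine dvd_of_diagonal_mul_eq hd.2 hd'.2 (P'⁻¹ * P).isUnit (W := W) ?_ i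
  rw [Units.val_mul, mul_assoc, hW, ← mul_assoc, ← mul_assoc, Units.inv_mul, one_mul]

theorem IsInvariantFactorsOfModule.unique {N : Submodule K[X] (Fin m → K[X])}
    {d d' : Fin m → K[X]} (h : IsInvariantFactorsOfModule N d)
    (h' : IsInvariantFactorsOfModule N d') : d = d' := by
  obtain ⟨hd, P, hP⟩ := isInvariantFactorsOfModule_iff.1 h
  obtain ⟨hd', P', hP'⟩ := isInvariantFactorsOfModule_iff.1 h'
  exact hd.eq_of_dvd hd' (dvd_of_range_le hd' hd (hP'.symm.trans hP).le)
    (dvd_of_range_le hd hd' (hP.symm.trans hP').le)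

/-- Right multiplication by a unimodular matrix preserves the column module; conversely,
nonsingularity of `A` makes the right factor unimodular. -/
theorem isInvariantFactorsOfMatrix_iff {A : Matrix (Fin m) (Fin m) K[X]} (hA : A.det ≠ 0)
    {d : Fin m → K[X]} : IsInvariantFactorsOfMatrix A d ↔
      IsInvariantFactorsOfModule (LinearMap.range A.mulVecLin) d := by
  rw [isInvariantFactorsOfModule_iff]
  refine and_congr_right fun _ => ?_
  constructor
  · rintro ⟨U, V, h⟩
    refine ⟨U⁻¹, le_antisymm ?_ ?_⟩ <;> rw [Matrix.range_le_range_iff, ← h]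
    · exact ⟨(V⁻¹ : (Matrix (Fin m) (Fin m) K[X])ˣ).val, by simp [mul_assoc]⟩
    · exact ⟨V.val, by simp [mul_assoc]⟩
  · rintro ⟨P, hP⟩
    obtain ⟨W, hW⟩ := Matrix.exists_unit_of_range_eq hA hP
    exact ⟨P⁻¹, W⁻¹, by rw [hW]; simp [mul_assoc]⟩

/-- The least degree of the determinant of a matrix of relations is attained by a basis. -/
theorem determinantalDegree_eq {N : Submodule K[X] (Fin m → K[X])} {d : Fin m → K[X]}
    (h : IsInvariantFactorsOfModule N d) (h0 : ∀ i, d i ≠ 0) :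
    determinantalDegree N = ∑ i, (d i).natDegree := by
  obtain ⟨hd, P, hP⟩ := isInvariantFactorsOfModule_iff.1 h
  have hunit : ∀ Q : (Matrix (Fin m) (Fin m) K[X])ˣ, IsUnit Q.val.det := fun Q =>
    (Matrix.isUnit_iff_isUnit_det _).1 Q.isUnit
  have hdet : (P.val * Matrix.diagonal d).det.natDegree = ∑ i, (d i).natDegree := by
    rw [Matrix.det_mul, Matrix.det_diagonal, natDegree_mul (hunit P).ne_zero
      (Finset.prod_ne_zero_iff.2 fun i _ => h0 i), natDegree_eq_zero_of_isUnit (hunit P), zero_add,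
      natDegree_prod _ _ fun i _ => h0 i]
  have hmem : ∑ i, (d i).natDegree ∈ {e | ∃ B : Matrix (Fin m) (Fin m) K[X],
      IsMatrixOfRelations N B ∧ B.det.natDegree = e} := by
    refine ⟨P.val * Matrix.diagonal d, ⟨?_, fun j => ?_⟩, hdet⟩
    · rw [Matrix.det_mul, Matrix.det_diagonal]
      exact mul_ne_zero (hunit P).ne_zero (Finset.prod_ne_zero_iff.2 fun i _ => h0 i)
    · rw [hP, Matrix.range_mulVecLin]
      exact Submodule.subset_span ⟨j, rfl⟩
  refine le_antisymm (Nat.sInf_le hmem) (le_csInf ⟨_, hmem⟩ ?_)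
  · rintro _ ⟨B, ⟨hB, hBN⟩, rfl⟩
    have hle : LinearMap.range B.mulVecLin ≤
        LinearMap.range (P.val * Matrix.diagonal d).mulVecLin := by
      rw [Matrix.range_mulVecLin, Submodule.span_le, ← hP]
      rintro _ ⟨j, rfl⟩
      exact hBN j
    obtain ⟨W, rfl⟩ := Matrix.range_le_range_iff.1 hle
    rw [← hdet]
    exact natDegree_le_of_dvd (Dvd.intro _ (Matrix.det_mul _ W).symm) hB

end InvariantFactors

/-! ### Degree counts and the main theorem -/

section MainTheorem

variable {K : Type*} [Field K]

theorem isInvariantFactorsOfModule_relationFactor (a : K[X]) {f : K[X]} (hf : f ≠ 0) (m : ℕ) :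
    IsInvariantFactorsOfModule (relationModule a f m) fun i => relationFactor a f i :=
  isInvariantFactorsOfModule_iff.2 ⟨⟨fun i => Or.inr (relationFactor_monic a hf i),
    fun _ _ h => relationFactor_dvd a hf h⟩, exists_relationModule_eq_range a hf m⟩

/-- The characteristic polynomial, of degree `n`, equals the product of the relation factors up to a
unit. -/
theorem sum_natDegree_relationFactor (a : K[X]) {f : K[X]} (hf : f ≠ 0) :
    ∑ i : Fin f.natDegree, (relationFactor a f i).natDegree = f.natDegree := by
  obtain ⟨P, hP⟩ := exists_relationModule_eq_range a hf f.natDegree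
  obtain ⟨W, hW⟩ := Matrix.exists_unit_of_range_eq
    (Matrix.charpoly_monic (mulMatrix a f hf)).ne_zero
    ((relationModule_eq_range_charmatrix a hf).symm.trans hP)
  have hunit : ∀ Q : (Matrix (Fin f.natDegree) (Fin f.natDegree) K[X])ˣ, IsUnit Q.val.det :=
    fun Q => (Matrix.isUnit_iff_isUnit_det _).1 Q.isUnit
  have h0 : ∀ i : Fin f.natDegree, relationFactor a f i ≠ 0 := fun i =>
    (relationFactor_monic a hf i).ne_zero
  have h0' := Finset.prod_ne_zero_iff.2 fun i (_ : i ∈ Finset.univ) => h0 i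
  have h1 := Matrix.charpoly_natDegree_eq_dim (mulMatrix a f hf)
  rwa [Fintype.card_fin, Matrix.charpoly, hW, Matrix.det_mul, Matrix.det_mul, Matrix.det_diagonal,
    natDegree_mul (mul_ne_zero (hunit P).ne_zero h0') (hunit W).ne_zero,
    natDegree_mul (hunit P).ne_zero h0', natDegree_eq_zero_of_isUnit (hunit P),
    natDegree_eq_zero_of_isUnit (hunit W), zero_add, add_zero,
    natDegree_prod _ _ fun i _ => h0 i] at h1

theorem diag_eq_of_upperTriangular (a : K[X]) {f : K[X]} (hf : f ≠ 0) {m : ℕ}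
    {B : Matrix (Fin m) (Fin m) K[X]} (hB : IsBasisOfRelations (relationModule a f m) B)
    (hT : B.BlockTriangular id) (i : Fin m) :
    ∃ c : K, c ≠ 0 ∧ B i i = C c * relationFactor a f i := by
  have hdvd : ∀ i : Fin m, relationFactor a f i ∣ B i i := fun i =>
    relationFactor_dvd_apply a hf (hB.1.2 i) fun j hj => hT hj
  choose c hc using hdvd
  obtain ⟨P, hP⟩ := exists_relationModule_eq_range a hf m
  have hspan := hB.2
  rw [Matrix.span_cols_eq_range, hP] at hspan
  obtain ⟨W, hW⟩ := Matrix.exists_unit_of_range_eq hB.1.1 hspan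
  have hprod : ∏ i : Fin m, relationFactor a f i ≠ 0 :=
    Finset.prod_ne_zero_iff.2 fun i _ => (relationFactor_monic a hf i).ne_zero
  -- Each diagonal entry is `c i` times a relation factor; comparing determinants of two bases makes
  -- the product of the `c i`, hence each `c i`, a unit.
  have hdet : ∏ i, c i = P.val.det * W.val.det := by
    apply mul_left_cancel₀ hprod
    rw [← Finset.prod_mul_distrib, ← Finset.prod_congr rfl fun i _ => hc i,
      ← Matrix.det_of_isUpperTriangular hT, hW, Matrix.det_mul, Matrix.det_mul,
      Matrix.det_diagonal]
    ring
  have hunit : IsUnit (∏ i, c i) := by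
    rw [hdet]
    exact ((Matrix.isUnit_iff_isUnit_det _).1 P.isUnit).mul
      ((Matrix.isUnit_iff_isUnit_det _).1 W.isUnit)
  obtain ⟨u, hu, hcu⟩ := Polynomial.isUnit_iff.1
    (isUnit_of_dvd_unit (Finset.dvd_prod_of_mem c (Finset.mem_univ i)) hunit)
  exact ⟨u, hu.ne_zero, by rw [hc, hcu, mul_comm]⟩

/-- The degree sum of the first `m` relation factors only involves those of index less than the
degree of `f`. -/
theorem sum_fin_natDegree_relationFactor (a : K[X]) {f : K[X]} (hf : f ≠ 0) (m : ℕ) :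
    ∑ i : Fin m, (relationFactor a f i).natDegree =
      ∑ i ∈ Finset.univ.filter (fun i : Fin f.natDegree => (i : ℕ) < m),
        (relationFactor a f i).natDegree := by
  rw [Finset.sum_filter,
    Fin.sum_univ_eq_sum_range (fun i => (relationFactor a f i).natDegree),
    Fin.sum_univ_eq_sum_range (fun i => if i < m then (relationFactor a f i).natDegree else 0),
    ← Finset.sum_filter]
  symm
  refine Finset.sum_subset (fun i hi => ?_) fun i _ hi => ?_
  · exact Finset.mem_range.2 (Finset.mem_filter.1 hi).2
  · have : f.natDegree ≤ i := by
      by_contra hlt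
      simp_all
    rw [relationFactor_eq_one a hf this, natDegree_one]

/-- The nonconstant relation factors form an initial segment. -/
theorem exists_isUnit_relationFactor_iff (a : K[X]) {f : K[X]} (hf : f ≠ 0) :
    ∃ k ≤ f.natDegree, ∀ i, ¬ IsUnit (relationFactor a f i) ↔ i < k := by
  classical
  have hex : ∃ k, IsUnit (relationFactor a f k) :=
    ⟨f.natDegree, by rw [relationFactor_eq_one a hf le_rfl]; exact isUnit_one⟩
  refine ⟨Nat.find hex, Nat.find_min' hex ?_, fun i => ⟨fun h => ?_, fun h => Nat.find_min hex h⟩⟩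
  · rw [relationFactor_eq_one a hf le_rfl]
    exact isUnit_one
  · by_contra hlt
    exact h (isUnit_of_dvd_unit (relationFactor_dvd a hf (not_lt.1 hlt)) (Nat.find_spec hex))

/-- Either all of the first `m` factors are nonconstant, each contributing at least 1, or they
include every nonconstant factor and the sum is the full `n`. -/
theorem min_le_sum_natDegree_relationFactor (a : K[X]) {f : K[X]} (hf : f ≠ 0) (m : ℕ) :
    min m f.natDegree ≤ ∑ i : Fin m, (relationFactor a f i).natDegree := by
  obtain ⟨k, hk, hunit⟩ := exists_isUnit_relationFactor_iff a hf
  rcases le_or_gt m k with hmk | hkm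
  · refine (min_le_left _ _).trans ?_
    calc m = ∑ _i : Fin m, 1 := by simp
      _ ≤ _ := Finset.sum_le_sum fun i _ => by
        rw [Nat.one_le_iff_ne_zero]
        intro h
        refine (hunit i).2 (i.isLt.trans_le hmk) ?_
        rw [(relationFactor_monic a hf i).natDegree_eq_zero.1 h]
        exact isUnit_one
  · refine (min_le_right _ _).trans ?_
    rw [← sum_natDegree_relationFactor a hf, sum_fin_natDegree_relationFactor a hf m,
      Finset.sum_filter]
    refine Finset.sum_le_sum fun i _ => ?_
    split_ifs with h
    · exact le_rfl
    · have : IsUnit (relationFactor a f i) := by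
        by_contra hi
        exact h (((hunit i).1 hi).trans hkm)
      rw [natDegree_eq_zero_of_isUnit this]

end MainTheorem

theorem mainTheorem6 {K : Type*} [Field K] (a f : K[X]) (hf : f ≠ 0) (m : ℕ) (hm : 1 ≤ m) :
    ∃ (d : Fin m → K[X]) (σ : Fin f.natDegree → K[X]),
      -- `d` is the list of invariant factors of the module of relations
      (∀ d', IsInvariantFactorsOfModule (relationModule a f m) d' ↔ d' = d) ∧
      -- `σ` is the list of invariant factors of the characteristic matrix
      (∀ σ', IsInvariantFactorsOfMatrix (mulMatrix a f hf).charmatrix σ' ↔ σ' = σ) ∧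
      -- diagonal entries of an upper triangular basis
      (∀ B : Matrix (Fin m) (Fin m) K[X], IsBasisOfRelations (relationModule a f m) B →
        B.BlockTriangular id → ∀ i, ∃ c : K, c ≠ 0 ∧ B i i = C c * d i) ∧
      -- the nontrivial invariant factors
      (∃ (k : ℕ) (hk : k ≤ min m f.natDegree),
        (∀ i : Fin m, ¬ IsUnit (d i) ↔ (i : ℕ) < k) ∧
        ∀ i : Fin k, d (i.castLE (hk.trans (min_le_left _ _))) =
          σ (i.castLE (hk.trans (min_le_right _ _)))) ∧
      -- the characteristic matrix is a basis of relations
      IsBasisOfRelations (relationModule a f f.natDegree) (mulMatrix a f hf).charmatrix ∧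
      -- the determinantal degree
      determinantalDegree (relationModule a f m) = ∑ i, (d i).natDegree ∧
      determinantalDegree (relationModule a f m) =
        ∑ i ∈ Finset.univ.filter (fun i : Fin f.natDegree => (i : ℕ) < m), (σ i).natDegree ∧
      min m f.natDegree ≤ determinantalDegree (relationModule a f m) ∧
      determinantalDegree (relationModule a f m) ≤ f.natDegree := by

  have hd := isInvariantFactorsOfModule_relationFactor a hf m
  have hdet : (mulMatrix a f hf).charmatrix.det ≠ 0 :=
    (Matrix.charpoly_monic (mulMatrix a f hf)).ne_zero
  have hN := relationModule_eq_range_charmatrix a hf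
  have hσ := isInvariantFactorsOfModule_relationFactor a hf f.natDegree
  have hdeg := determinantalDegree_eq hd fun i => (relationFactor_monic a hf i).ne_zero
  refine ⟨fun i => relationFactor a f i, fun i => relationFactor a f i,
    fun d' => ⟨fun h => h.unique hd, fun h => h ▸ hd⟩, fun σ' => ?_,
    fun B hB hT => diag_eq_of_upperTriangular a hf hB hT, ?_, ⟨⟨hdet, fun j => ?_⟩, ?_⟩, hdeg,
    hdeg.trans (sum_fin_natDegree_relationFactor a hf m),
    hdeg ▸ min_le_sum_natDegree_relationFactor a hf m, ?_⟩
  · rw [isInvariantFactorsOfMatrix_iff hdet, ← hN]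
    exact ⟨fun h => h.unique hσ, fun h => h ▸ hσ⟩
  · obtain ⟨k, hk, hunit⟩ := exists_isUnit_relationFactor_iff a hf
    -- The threshold `k` does not depend on `m`; only the factors of index less than `m` are listed
    -- in `d`.
    refine ⟨min m k, min_le_min_left m hk, fun i => ?_, fun i => rfl⟩
    rw [hunit, lt_min_iff, and_iff_right i.isLt]
  · exact charmatrix_col_mem_relationModule a hf j
  · rw [Matrix.span_cols_eq_range, hN]
  · rw [hdeg, sum_fin_natDegree_relationFactor a hf m]
    exact (Finset.sum_le_sum_of_subset (Finset.filter_subset _ _)).trans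
      (sum_natDegree_relationFactor a hf).le
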